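/- Consider unconstrained online linear optimization on $\mathbb{R}^d$, $d\ge 1$, with Euclidean norm $\|\cdot\|$. A deterministic algorithm $\mathcal{A}$ predicts in each round $t=1,2,\dots$ a vector $x_t\in\mathbb{R}^d$ that is a function of the past gradients $g_1,\dots,g_{t-1}$; an adversary $adv$ then chooses $g_t$ with $\|g_t\|\le 1$ as an arbitrary function of $x_1,\dots,x_t$. The regret is $$\mathrm{Regret}_T^{\mathcal{A},adv}(u)=\sum_{t=1}^T\langle g_t,x_t\rangle-\sum_{t=1}^T\langle g_t,u\rangle,\qquad u\in\mathbb{R}^d .$$ For $C>0$ let $$\bar V_{1/2}(t,S)=C\sqrt t\left[2\int_0^{S/\sqrt{2t}}\left(\int_0^v e^{x^2}\,dx\right)dv-1\right],\qquad t>0,\ S\in\mathbb{R},$$ and let $\mathcal{A}_{1/2}$ (with parameter $C$) be the following algorithm. Start with $z_1=0\in\mathbb{R}^d$ and $S_1=0\in\mathbb{R}$. In round $t$, predict $x_t=y_tz_t$ with $y_t=\frac12\left[\bar V_{1/2}(t,S_t+1)-\bar V_{1/2}(t,S_t-1)\right]$; after observing $g_t$, set $S_{t+1}=S_t-\langle g_t,z_t\rangle$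 and $z_{t+1}=\Pi(z_t-g_t/\sqrt t)$, where $\Pi$ is the Euclidean projection onto the closed unit ball. (i) For every $C>0$, $$\limsup_{U\to\infty}\ \limsup_{T\to\infty}\ \sup_{\|u\|=U,\ adv}\frac{\mathrm{Regret}_T^{\mathcal{A}_{1/2},adv}(u)}{\|u\|\sqrt{T\log\|u\|}}\le\sqrt2 .$$ (ii) Conversely, for every $C\in\mathbb{R}$ and every algorithm $\mathcal{A}$ such that $\mathrm{Regret}_T^{\mathcal{A},adv}(0)\le C\sqrt T$ for all adversaries $adv$ and all $T\ge1$, $$\liminf_{U\to\infty}\ \liminf_{T\to\infty}\ \sup_{\|u\|=U,\ adv}\frac{\mathrm{Regret}_T^{\mathcal{A},adv}(u)}{\|u\|\sqrt{T\log\|u\|}}\ge\sqrt2 .$$ (iii) For every $C>0$, the algorithm $\mathcal{A}_{1/2}$ with parameter $C$ satisfies the condition in (ii) with the same $C$; hence its leading constant $\sqrt2$ is optimal. -/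

import Mathlib

/-! Unconstrained online linear optimization (OLO) on `ℝ^d`.
Rounds are indexed from `0`: index `t : ℕ` is the `(t + 1)`-st round. -/

namespace OLO

/-- Euclidean space `ℝ^d`. -/
abbrev E (d : ℕ) : Type := EuclideanSpace ℝ (Fin d)

/-- Admissible loss gradients: vectors of Euclidean norm at most `1`. -/
abbrev Gradient (d : ℕ) : Type := Metric.closedBall (0 : E d) 1

/-- A deterministic OLO algorithm: the prediction of round `t` is a function of the `t` loss
gradients observed before. -/
abbrev Algorithm (d : ℕ) : Type := (t : ℕ) → (Fin t → Gradient d) → E d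

/-- An adversary: the loss gradient of round `t` is an arbitrary function of all predictions
made up to and including round `t`. -/
abbrev Adversary (d : ℕ) : Type := (t : ℕ) → (Fin (t + 1) → E d) → Gradient d

noncomputable section

/-- The first `t` loss gradients in the game between an algorithm and an adversary. -/
def history {d : ℕ} (A : Algorithm d) (adv : Adversary d) : (t : ℕ) → Fin t → Gradient d
  | 0 => Fin.elim0
  | t + 1 =>
    Fin.snoc (α := fun _ => Gradient d) (history A adv t)
      (adv t fun s : Fin (t + 1) =>
        A s fun i : Fin s => history A adv t (Fin.castLE (Nat.lt_succ_iff.mp s.isLt) i))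

/-- The prediction of round `t` in the game. -/
def prediction {d : ℕ} (A : Algorithm d) (adv : Adversary d) (t : ℕ) : E d :=
  A t (history A adv t)

/-- The loss gradient of round `t` in the game. -/
def lossGradient {d : ℕ} (A : Algorithm d) (adv : Adversary d) (t : ℕ) : E d :=
  (history A adv (t + 1) (Fin.last t) : E d)

/-- The regret after `T` rounds with respect to the comparator `u`. -/
def regret {d : ℕ} (A : Algorithm d) (adv : Adversary d) (T : ℕ) (u : E d) : ℝ :=
  ∑ t ∈ Finset.range T, inner ℝ (lossGradient A adv t) (prediction A adv t)
    - ∑ t ∈ Finset.range T, inner ℝ (lossGradient A adv t) u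

/-- The supremum over all adversaries and all comparators of norm `U` of
`regret / (‖u‖ √(T log ‖u‖))`, as an extended real number. -/
def worstRatio {d : ℕ} (A : Algorithm d) (U : ℝ) (T : ℕ) : EReal :=
  ⨆ (u : E d) (_ : ‖u‖ = U) (adv : Adversary d),
    ((regret A adv T u / (‖u‖ * √(T * Real.log ‖u‖)) : ℝ) : EReal)

/-- The Euclidean projection onto the closed unit ball. -/
def projBall {d : ℕ} (v : E d) : E d := (max 1 ‖v‖)⁻¹ • v

/-- Projected online gradient descent on the unit ball, started at the origin, with learning
rate `1 / √t` in the `t`-th round (counted from `1`). -/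
def ogd {d : ℕ} : Algorithm d
  | 0, _ => 0
  | t + 1, g => projBall (ogd t (Fin.init g) - (1 / √((t : ℝ) + 1)) • (g (Fin.last t) : E d))

/-- The statistic `S`, equal to minus the sum of the past inner products `⟪g, z⟫`, where `z` is
the prediction of online gradient descent. -/
def statistic {d : ℕ} : (t : ℕ) → (Fin t → Gradient d) → ℝ
  | 0, _ => 0
  | t + 1, g =>
    statistic t (Fin.init g) - inner ℝ (g (Fin.last t) : E d) (ogd t (Fin.init g))

/-- The OLO algorithm constructed from a one-dimensional potential `V (t, S)`. -/
def potentialAlgorithm (d : ℕ) (V : ℝ → ℝ → ℝ) : Algorithm d := fun t g =>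
  ((V ((t : ℝ) + 1) (statistic t g + 1) - V ((t : ℝ) + 1) (statistic t g - 1)) / 2) • ogd t g

/-- The potential `V_{1/2}` with scaling constant `C`. -/
def potentialHalf (C : ℝ) (t S : ℝ) : ℝ :=
  C * √t * (2 * (∫ v in (0 : ℝ)..(S / √(2 * t)), ∫ x in (0 : ℝ)..v, Real.exp (x ^ 2)) - 1)

/-- The algorithm `A_{1/2}` with scaling constant `C`. -/
def algorithmHalf (d : ℕ) (C : ℝ) : Algorithm d := potentialAlgorithm d (potentialHalf C)

end

end OLO

/-!
Upper bound: the potential `V = V_{1/2}` is convex in `S` and solves the backward heat equation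
`2 ∂V/∂t + ∂²V/∂S² = 0`, and `∂²V/∂S²` is convex in `S`. Along the parabola `(t + r², S ± r)` the
symmetrized potential changes at a rate equal to minus the error of the trapezoidal rule for
`∂²V/∂S²`, so `V` is a supersolution for the random walk with unit steps and the losses telescope.
Online gradient descent on the unit ball replaces the comparator `u` by `‖u‖` at the cost of
`O(‖u‖ √T)`, and the convex conjugate of `V (T, ·)` at `U` is `U √(2 T log U) + O(U √T)`.

Lower bound: against any algorithm some path of the random walk does at least as well as the
average path, for the sum of the loss and any function of the endpoint. Taking for this function a
large multiple of a combination of exponentials that is positive only near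
`√T (√(2 log U) - 2)` forces the walk to end there, while the loss stays above `-O(U √T)`.
-/

namespace OLO

open Filter Set Topology

noncomputable section

/-! ### Convex functions and the backward heat equation -/

theorem add_mul_sub_le_of_convexOn {s : Set ℝ} {f : ℝ → ℝ} {f' x y : ℝ} (hf : ConvexOn ℝ s f)
    (hx : x ∈ s) (hy : y ∈ s) (hf' : HasDerivAt f f' x) : f x + f' * (y - x) ≤ f y := by
  rcases lt_trichotomy x y with hxy | rfl | hyx
  · have hslope := hf.le_slope_of_hasDerivAt hx hy hxy hf'
    rw [slope_def_field, le_div_iff₀ (sub_pos.2 hxy)] at hslope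
    linarith
  · simp
  · have hslope := hf.slope_le_of_hasDerivAt hy hx hyx hf'
    rw [slope_def_field, div_le_iff₀ (sub_pos.2 hyx)] at hslope
    linarith

theorem convexOn_exp_comp {F : Type*} [AddCommGroup F] [Module ℝ F] {s : Set F} {f : F → ℝ}
    (hf : ConvexOn ℝ s f) : ConvexOn ℝ s fun x => Real.exp (f x) :=
  ⟨hf.1, fun _ hx _ hy _ _ ha hb hab =>
    (Real.exp_le_exp.2 (hf.2 hx hy ha hb hab)).trans
      (convexOn_exp.2 (mem_univ _) (mem_univ _) ha hb hab)⟩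

theorem le_chord_of_convexOn {f : ℝ → ℝ} {x c : ℝ} (hf : ConvexOn ℝ (Icc (x - 1) (x + 1)) f)
    (hc : |c| ≤ 1) :
    f (x - c) ≤ (f (x + 1) + f (x - 1)) / 2 - c * ((f (x + 1) - f (x - 1)) / 2) := by
  obtain ⟨hc₁, hc₂⟩ := abs_le.1 hc
  have hchord := hf.2 (right_mem_Icc.2 (by linarith)) (left_mem_Icc.2 (by linarith))
    (by linarith : 0 ≤ (1 - c) / 2) (by linarith : 0 ≤ (1 + c) / 2) (by ring)
  have hpoint : ((1 - c) / 2) • (x + 1) + ((1 + c) / 2) • (x - 1) = x - c := by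
    simp only [smul_eq_mul]; ring
  rw [hpoint] at hchord
  simp only [smul_eq_mul] at hchord
  linarith

theorem add_reflect_le_of_convexOn {f : ℝ → ℝ} {a b x : ℝ} (hf : ConvexOn ℝ (Icc a b) f)
    (hx : x ∈ Icc a b) : f x + f (a + b - x) ≤ f a + f b := by
  have hab : a ≤ b := hx.1.trans hx.2
  obtain ⟨r, s, hr, hs, hrs, rfl⟩ := (segment_eq_Icc hab).symm ▸ hx
  have hreflect : a + b - (r • a + s • b) = s • a + r • b := by
    simp only [smul_eq_mul]; linear_combination -(a + b) * hrs
  have h₁ := hf.2 (left_mem_Icc.2 hab) (right_mem_Icc.2 hab) hr hs hrs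
  have h₂ := hf.2 (left_mem_Icc.2 hab) (right_mem_Icc.2 hab) hs hr (by linarith)
  rw [hreflect]
  refine (add_le_add h₁ h₂).trans_eq ?_
  simp only [smul_eq_mul]
  linear_combination (f a + f b) * hrs

theorem integral_le_trapezoid_of_convexOn {f : ℝ → ℝ} {a b : ℝ} (hab : a ≤ b)
    (hf : ConvexOn ℝ (Icc a b) f) (hint : IntervalIntegrable f MeasureTheory.volume a b) :
    ∫ x in a..b, f x ≤ (b - a) * ((f a + f b) / 2) := by
  have hint' : IntervalIntegrable (fun x => f (a + b - x)) MeasureTheory.volume a b := by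
    simpa using (hint.comp_sub_left (a + b)).symm
  have hreflect : ∫ x in a..b, f (a + b - x) = ∫ x in a..b, f x := by simp
  have hsum : ∫ x in a..b, (f x + f (a + b - x)) ≤ ∫ _ in a..b, (f a + f b) :=
    intervalIntegral.integral_mono_on hab (hint.add hint') (by simp)
      fun x hx => add_reflect_le_of_convexOn hf hx
  rw [intervalIntegral.integral_add hint hint', hreflect, intervalIntegral.integral_const,
    smul_eq_mul] at hsum
  linarith

/-- The transition operator of the simple random walk on `ℝ` with steps `±1`, so that
`(walkAverage ^ n) f S` is the expectation of `f` after `n` steps from `S`. -/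
def walkAverage : Module.End ℝ (ℝ → ℝ) where
  toFun f S := (f (S + 1) + f (S - 1)) / 2
  map_add' f g := by ext S; simp only [Pi.add_apply]; ring
  map_smul' c f := by
    ext S
    simp only [Pi.smul_apply, smul_eq_mul, RingHom.id_apply]
    ring

theorem walkAverage_apply (f : ℝ → ℝ) (S : ℝ) :
    walkAverage f S = (f (S + 1) + f (S - 1)) / 2 := rfl

/- The hypothesis `hV` is the chain rule along the parabola `(τ + r ^ 2, x + r)` for a solution of
`2 * ∂V/∂t + V'' = 0`. -/
theorem walkAverage_le_of_backward_heat {V V' V'' : ℝ → ℝ → ℝ} {τ x : ℝ}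
    (hV : ∀ r, HasDerivAt (fun r => V (τ + r ^ 2) (x + r))
      (V' (τ + r ^ 2) (x + r) - r * V'' (τ + r ^ 2) (x + r)) r)
    (hV' : ∀ r y, HasDerivAt (V' (τ + r ^ 2)) (V'' (τ + r ^ 2) y) y)
    (hV'' : ∀ r, ConvexOn ℝ univ (V'' (τ + r ^ 2))) :
    walkAverage (V (τ + 1)) x ≤ V τ x := by
  have hd (r : ℝ) := (hV r).add ((hV (-r)).comp r (hasDerivAt_neg r))
  have hanti : AntitoneOn (fun r => V (τ + r ^ 2) (x + r) + V (τ + (-r) ^ 2) (x + -r))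
      (Icc 0 1) := by
    refine antitoneOn_of_hasDerivWithinAt_nonpos (convex_Icc 0 1)
      (fun r _ => (hd r).continuousAt.continuousWithinAt)
      (fun r _ => (hd r).hasDerivWithinAt) fun r hr => ?_
    have hr₀ : 0 ≤ r := (interior_subset hr).1
    have hint : IntervalIntegrable (V'' (τ + r ^ 2)) MeasureTheory.volume (x + -r) (x + r) :=
      (continuousOn_univ.1 ((hV'' r).continuousOn isOpen_univ)).intervalIntegrable _ _
    have htrap := integral_le_trapezoid_of_convexOn (by linarith)
      ((hV'' r).subset (subset_univ _) (convex_Icc (x + -r) (x + r))) hint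
    rw [intervalIntegral.integral_eq_sub_of_hasDerivAt (fun y _ => hV' r y) hint] at htrap
    simp only [neg_sq]
    linear_combination htrap
  have hends := hanti (left_mem_Icc.2 zero_le_one) (right_mem_Icc.2 zero_le_one) zero_le_one
  simp only [neg_sq, one_pow, ne_eq, OfNat.ofNat_ne_zero, not_false_eq_true, zero_pow, add_zero,
    neg_zero, ← sub_eq_add_neg] at hends
  rw [walkAverage_apply]
  linarith

/-! ### The potential -/

/-- `√π / 2` times the imaginary error function. -/
def expSqIntegral (z : ℝ) : ℝ := ∫ x in (0 : ℝ)..z, Real.exp (x ^ 2)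

/-- The antiderivative of `expSqIntegral` that vanishes at `0`, which gives the profile of the
potential `V_{1/2}` in the variable `S / √(2 t)`. -/
def expSqDoubleIntegral (z : ℝ) : ℝ := ∫ v in (0 : ℝ)..z, expSqIntegral v

theorem hasDerivAt_expSqIntegral (z : ℝ) : HasDerivAt expSqIntegral (Real.exp (z ^ 2)) z :=
  (by fun_prop : Continuous fun x : ℝ => Real.exp (x ^ 2)).integral_hasStrictDerivAt 0 z
    |>.hasDerivAt

theorem continuous_expSqIntegral : Continuous expSqIntegral :=
  continuous_iff_continuousAt.2 fun z => (hasDerivAt_expSqIntegral z).continuousAt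

theorem hasDerivAt_expSqDoubleIntegral (z : ℝ) :
    HasDerivAt expSqDoubleIntegral (expSqIntegral z) z :=
  (continuous_expSqIntegral.integral_hasStrictDerivAt 0 z).hasDerivAt

@[simp]
theorem expSqIntegral_zero : expSqIntegral 0 = 0 := by simp [expSqIntegral]

@[simp]
theorem expSqDoubleIntegral_zero : expSqDoubleIntegral 0 = 0 := by simp [expSqDoubleIntegral]

theorem monotone_expSqIntegral : Monotone expSqIntegral :=
  monotone_of_hasDerivAt_nonneg hasDerivAt_expSqIntegral fun z => (Real.exp_pos (z ^ 2)).le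

theorem convexOn_expSqDoubleIntegral : ConvexOn ℝ univ expSqDoubleIntegral := by
  refine Monotone.convexOn_univ_of_deriv
    (fun z => (hasDerivAt_expSqDoubleIntegral z).differentiableAt) ?_
  rw [funext fun z => (hasDerivAt_expSqDoubleIntegral z).deriv]
  exact monotone_expSqIntegral

theorem expSqDoubleIntegral_nonneg (z : ℝ) : 0 ≤ expSqDoubleIntegral z := by
  simpa using add_mul_sub_le_of_convexOn convexOn_expSqDoubleIntegral (mem_univ 0) (mem_univ z)
    (hasDerivAt_expSqDoubleIntegral 0)

theorem mul_sub_le_expSqDoubleIntegral {b k : ℝ} (hk₀ : 0 ≤ k) (hk : k ≤ expSqIntegral b) (z : ℝ) :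
    k * (z - b) ≤ expSqDoubleIntegral z := by
  rcases le_total z b with hz | hz
  · exact (mul_nonpos_of_nonneg_of_nonpos hk₀ (sub_nonpos.2 hz)).trans
      (expSqDoubleIntegral_nonneg z)
  · have htangent := add_mul_sub_le_of_convexOn convexOn_expSqDoubleIntegral (mem_univ b)
      (mem_univ z) (hasDerivAt_expSqDoubleIntegral b)
    have hslope := mul_le_mul_of_nonneg_right hk (sub_nonneg.2 hz)
    linarith [expSqDoubleIntegral_nonneg b]

theorem two_mul_expSqDoubleIntegral (z : ℝ) :
    2 * expSqDoubleIntegral z = 2 * z * expSqIntegral z - Real.exp (z ^ 2) + 1 := by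
  have hd (z : ℝ) : HasDerivAt (fun z => 2 * expSqDoubleIntegral z -
      (2 * z * expSqIntegral z - Real.exp (z ^ 2))) 0 z := by
    have hexp := ((hasDerivAt_id z).pow 2).exp
    have hmul := ((hasDerivAt_id z).const_mul 2).mul (hasDerivAt_expSqIntegral z)
    refine (((hasDerivAt_expSqDoubleIntegral z).const_mul 2).sub (hmul.sub hexp)).congr_deriv ?_
    simp only [id_eq, Nat.cast_ofNat, Nat.add_one_sub_one, pow_one, mul_one, Pi.pow_apply]
    ring
  have hconst := is_const_of_deriv_eq_zero (fun z => (hd z).differentiableAt)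
    (fun z => (hd z).deriv) z 0
  simp only [expSqDoubleIntegral_zero, expSqIntegral_zero, mul_zero, ne_eq, OfNat.ofNat_ne_zero,
    not_false_eq_true, zero_pow, Real.exp_zero] at hconst
  linarith

theorem mul_exp_sq_le_expSqIntegral_add {y k : ℝ} (hy : 0 ≤ y) (hk : 0 ≤ k) :
    k * Real.exp (y ^ 2) ≤ expSqIntegral (y + k) := by
  have hincrement := (convex_Ici y).mul_sub_le_image_sub_of_le_deriv
    continuous_expSqIntegral.continuousOn
    (fun x _ => (hasDerivAt_expSqIntegral x).differentiableAt.differentiableWithinAt)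
    (C := Real.exp (y ^ 2))
    (fun x hx => by
      rw [(hasDerivAt_expSqIntegral x).deriv]
      exact Real.exp_le_exp.2 (pow_le_pow_left₀ hy (interior_subset hx) 2))
    y self_mem_Ici (y + k) (le_add_of_nonneg_right hk) (le_add_of_nonneg_right hk)
  have hnonneg := monotone_expSqIntegral hy
  rw [expSqIntegral_zero] at hnonneg
  linarith

theorem potentialHalf_eq (C t S : ℝ) :
    potentialHalf C t S = C * √t * (2 * expSqDoubleIntegral (S / √(2 * t)) - 1) := rfl

theorem potentialHalf_one_zero (C : ℝ) : potentialHalf C 1 0 = -C := by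
  simp [potentialHalf_eq]

theorem convexOn_potentialHalf {C : ℝ} (hC : 0 ≤ C) (t : ℝ) :
    ConvexOn ℝ univ (potentialHalf C t) := by
  have hprofile : ConvexOn ℝ univ fun S => expSqDoubleIntegral (S / √(2 * t)) := by
    simpa only [Function.comp_def, div_eq_inv_mul, preimage_univ, LinearMap.mulLeft_apply] using
      convexOn_expSqDoubleIntegral.comp_linearMap (LinearMap.mulLeft ℝ (√(2 * t))⁻¹)
  exact ((hprofile.smul zero_le_two).sub (concaveOn_const 1 convex_univ)).smul (by positivity)

theorem hasDerivAt_potentialHalf_comp (C : ℝ) {t S : ℝ → ℝ} {t' S' r : ℝ}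
    (ht : HasDerivAt t t' r) (hS : HasDerivAt S S' r) (hpos : 0 < t r) :
    HasDerivAt (fun r => potentialHalf C (t r) (S r))
      (C * √2 * expSqIntegral (S r / √(2 * t r)) * S'
        - C / (2 * √(t r)) * Real.exp ((S r / √(2 * t r)) ^ 2) * t') r := by
  have hroot := ht.sqrt hpos.ne'
  have hz := hS.div ((ht.const_mul 2).sqrt (by positivity)) (by positivity)
  have hV := (hroot.const_mul C).mul
    ((((hasDerivAt_expSqDoubleIntegral _).comp r hz).const_mul 2).sub_const 1)
  refine hV.congr_deriv ?_
  have hr : 0 < √(t r) := Real.sqrt_pos.2 hpos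
  simp only [Function.comp_apply, Pi.div_apply, two_mul_expSqDoubleIntegral,
    Real.sqrt_mul zero_le_two]
  generalize √(t r) = w at *
  generalize expSqIntegral (S r / (√2 * w)) = G
  generalize Real.exp ((S r / (√2 * w)) ^ 2) = X
  have h2 : √2 ^ 2 = (2 : ℝ) := Real.sq_sqrt zero_le_two
  field_simp
  linear_combination (2 * C * t' * S r * G - 2 * C * √2 ^ 2 * G * w ^ 2 * S') * h2

theorem walkAverage_potentialHalf_le {C t : ℝ} (hC : 0 ≤ C) (ht : 0 < t) (S : ℝ) :
    walkAverage (potentialHalf C (t + 1)) S ≤ potentialHalf C t S := by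
  refine walkAverage_le_of_backward_heat
    (V' := fun t S => C * √2 * expSqIntegral (S / √(2 * t)))
    (V'' := fun t S => C / √t * Real.exp ((S / √(2 * t)) ^ 2)) (fun r => ?_) (fun r S => ?_)
    fun r => ?_
  · have hparabola := ((hasDerivAt_id r).pow 2).const_add t
    refine (hasDerivAt_potentialHalf_comp C hparabola ((hasDerivAt_id r).const_add S)
      (by positivity : 0 < t + r ^ 2)).congr_deriv ?_
    simp only [id_eq, Pi.pow_apply, Nat.ofNat_nonneg, Real.sqrt_mul, mul_one, Nat.cast_ofNat,
      Nat.add_one_sub_one, pow_one, sub_right_inj]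
    field_simp
  · refine (((hasDerivAt_expSqIntegral _).comp S
      ((hasDerivAt_id S).div_const _)).const_mul _).congr_deriv ?_
    rw [Real.sqrt_mul zero_le_two]
    simp only [id_eq, one_div, mul_inv_rev]
    field_simp
  · have hsq : ConvexOn ℝ univ fun S : ℝ => (S / √(2 * (t + r ^ 2))) ^ 2 := by
      simpa only [div_eq_inv_mul, mul_pow, smul_eq_mul] using
        (even_two.convexOn_pow (𝕜 := ℝ)).smul (sq_nonneg (√(2 * (t + r ^ 2)))⁻¹)
    exact (convexOn_exp_comp hsq).smul (by positivity)

theorem mul_sub_potentialHalf_le_of_le_expSqIntegral {C t U b : ℝ} (hC : 0 < C) (ht : 0 < t)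
    (hU : 0 ≤ U) (hb : U ≤ √2 * C * expSqIntegral b) (S : ℝ) :
    U * S - potentialHalf C t S ≤ √t * (√2 * U * b + C) := by
  have hslope : U / (√2 * C) ≤ expSqIntegral b := by
    rwa [div_le_iff₀' (by positivity)]
  have hprofile := mul_sub_le_expSqDoubleIntegral (by positivity) hslope (S / √(2 * t))
  have hroot : √2 * √2 = (2 : ℝ) := Real.mul_self_sqrt zero_le_two
  have hscale := mul_le_mul_of_nonneg_left hprofile (by positivity : 0 ≤ 2 * C * √t)
  have hleft : 2 * C * √t * (U / (√2 * C) * (S / √(2 * t) - b)) = U * S - √t * (√2 * U * b) := by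
    rw [Real.sqrt_mul zero_le_two]
    field_simp
    linear_combination (U * √t * √2 * b - U * S) * hroot
  rw [potentialHalf_eq]
  linarith

theorem mul_sub_potentialHalf_le {C t U : ℝ} (hC : 0 < C) (ht : 0 < t) (hU : 1 ≤ U) (S : ℝ) :
    U * S - potentialHalf C t S ≤ √t * (√2 * U * √(Real.log U) + U / C + C) := by
  have hU₀ : 0 < U := one_pos.trans_le hU
  have hslope : U ≤ √2 * C * expSqIntegral (√(Real.log U) + 1 / (√2 * C)) := by
    have hgrowth := mul_exp_sq_le_expSqIntegral_add (Real.sqrt_nonneg (Real.log U))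
      (by positivity : 0 ≤ 1 / (√2 * C))
    rwa [Real.sq_sqrt (Real.log_nonneg hU), Real.exp_log hU₀, one_div_mul_eq_div,
      div_le_iff₀' (by positivity)] at hgrowth
  refine (mul_sub_potentialHalf_le_of_le_expSqIntegral hC ht hU₀.le hslope S).trans_eq ?_
  field_simp

/-! ### Online gradient descent and potential-based regret -/

theorem norm_sub_le_norm_smul_sub {F : Type*} [NormedAddCommGroup F] [InnerProductSpace ℝ F]
    {p v : F} {c : ℝ} (hc : 1 ≤ c) (hpv : inner ℝ p v ≤ ‖p‖ ^ 2) : ‖p - v‖ ≤ ‖c • p - v‖ := by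
  refine le_of_sq_le_sq ?_ (norm_nonneg _)
  rw [norm_sub_sq_real, norm_sub_sq_real, norm_smul, mul_pow, Real.norm_eq_abs, sq_abs,
    real_inner_smul_left]
  nlinarith [mul_nonneg (sub_nonneg.2 hc) (sub_nonneg.2 hpv), mul_nonneg (sq_nonneg (c - 1))
    (sq_nonneg ‖p‖)]

theorem one_div_two_mul_sqrt_add_one_le {x : ℝ} (hx : 0 ≤ x) :
    1 / (2 * √(x + 1)) ≤ √(x + 1) - √x := by
  have hsq : √(x + 1) ^ 2 - √x ^ 2 = 1 := by
    rw [Real.sq_sqrt (by linarith), Real.sq_sqrt hx]; ring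
  rw [div_le_iff₀ (by positivity)]
  linarith [sq_nonneg (√(x + 1) - √x)]

variable {d : ℕ}

theorem norm_projBall_le (w : E d) : ‖projBall w‖ ≤ 1 := by
  have hpos : 0 < max 1 ‖w‖ := lt_max_of_lt_left one_pos
  rw [projBall, norm_smul, norm_inv, Real.norm_of_nonneg hpos.le, inv_mul_le_iff₀ hpos, mul_one]
  exact le_max_right _ _

theorem norm_projBall_sub_le (w : E d) {v : E d} (hv : ‖v‖ ≤ 1) : ‖projBall w - v‖ ≤ ‖w - v‖ := by
  rcases le_or_gt ‖w‖ 1 with hw | hw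
  · simp [projBall, max_eq_left hw]
  have hscale : ‖w‖ • projBall w = w := by
    rw [projBall, max_eq_right hw.le, smul_inv_smul₀ (by positivity)]
  have hnorm : ‖projBall w‖ = 1 := by
    rw [projBall, max_eq_right hw.le, norm_smul, norm_inv, norm_norm,
      inv_mul_cancel₀ (by positivity)]
  have hinner : inner ℝ (projBall w) v ≤ ‖projBall w‖ ^ 2 := by
    refine (real_inner_le_norm _ _).trans ?_
    rwa [hnorm, one_mul, one_pow]
  simpa only [hscale] using norm_sub_le_norm_smul_sub hw.le hinner

theorem inner_sub_le_of_projBall_step {η : ℝ} (hη : 0 < η) (z g : E d) {v : E d} (hv : ‖v‖ ≤ 1) :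
    inner ℝ g (z - v) ≤
      (‖z - v‖ ^ 2 - ‖projBall (z - η • g) - v‖ ^ 2) / (2 * η) + η / 2 * ‖g‖ ^ 2 := by
  have hcontract := pow_le_pow_left₀ (norm_nonneg _) (norm_projBall_sub_le (z - η • g) hv) 2
  rw [sub_right_comm, norm_sub_sq_real (z - v), real_inner_smul_right, norm_smul,
    Real.norm_of_nonneg hη.le, real_inner_comm] at hcontract
  have hscaled : inner ℝ g (z - v) - η / 2 * ‖g‖ ^ 2 ≤
      (‖z - v‖ ^ 2 - ‖projBall (z - η • g) - v‖ ^ 2) / (2 * η) := by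
    rw [le_div_iff₀ (by positivity)]
    linarith
  linarith

theorem sum_inner_sub_le_of_projBall_step {z g : ℕ → E d} {v : E d} (hz : ∀ t, ‖z t‖ ≤ 1)
    (hg : ∀ t, ‖g t‖ ≤ 1) (hstep : ∀ t, z (t + 1) = projBall (z t - (1 / √((t : ℝ) + 1)) • g t))
    (hv : ‖v‖ ≤ 1) (T : ℕ) :
    ∑ t ∈ Finset.range T, inner ℝ (g t) (z t - v) ≤ 3 * √(T : ℝ) := by
  suffices hpotential : ∑ t ∈ Finset.range T, inner ℝ (g t) (z t - v)
      ≤ 3 * √(T : ℝ) - √(T : ℝ) / 2 * ‖z T - v‖ ^ 2 from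
    hpotential.trans (sub_le_self _ (by positivity))
  induction T with
  | zero => simp
  | succ T ih =>
    have hroot : 0 < √((T : ℝ) + 1) := Real.sqrt_pos.2 (by positivity)
    have hmono : √(T : ℝ) ≤ √((T : ℝ) + 1) := Real.sqrt_le_sqrt (by linarith)
    have hdist : ‖z T - v‖ ^ 2 ≤ 4 := by
      have hle : ‖z T - v‖ ≤ 2 := (norm_sub_le _ _).trans (by linarith [hz T])
      exact (pow_le_pow_left₀ (norm_nonneg _) hle 2).trans_eq (by norm_num)
    have hround : inner ℝ (g T) (z T - v) ≤ √((T : ℝ) + 1) / 2 *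
        (‖z T - v‖ ^ 2 - ‖z (T + 1) - v‖ ^ 2) + 1 / (2 * √((T : ℝ) + 1)) := by
      rw [hstep]
      refine (inner_sub_le_of_projBall_step (one_div_pos.2 hroot) (z T) (g T) hv).trans
        (add_le_add (le_of_eq ?_) ?_)
      · field_simp
      · refine (mul_le_of_le_one_right (by positivity)
          (pow_le_one₀ (norm_nonneg _) (hg T))).trans_eq ?_
        field_simp
    have hrate := one_div_two_mul_sqrt_add_one_le (T.cast_nonneg : (0 : ℝ) ≤ T)
    rw [Finset.sum_range_succ]
    push_cast
    linarith [mul_le_mul_of_nonneg_left hdist (sub_nonneg.2 hmono)]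

theorem norm_lossGradient_le (A : Algorithm d) (adv : Adversary d) (t : ℕ) :
    ‖lossGradient A adv t‖ ≤ 1 :=
  mem_closedBall_zero_iff.1 (history A adv (t + 1) (Fin.last t)).2

theorem init_history (A : Algorithm d) (adv : Adversary d) (t : ℕ) :
    Fin.init (history A adv (t + 1)) = history A adv t := by
  simp only [history]
  exact Fin.init_snoc (α := fun _ => Gradient d) _ _

theorem regret_eq_regret_zero_sub (A : Algorithm d) (adv : Adversary d) (T : ℕ) (u : E d) :
    regret A adv T u =
      regret A adv T 0 - ∑ t ∈ Finset.range T, inner ℝ (lossGradient A adv t) u := by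
  simp [regret]

theorem regret_succ (A : Algorithm d) (adv : Adversary d) (T : ℕ) (u : E d) :
    regret A adv (T + 1) u =
      regret A adv T u + inner ℝ (lossGradient A adv T) (prediction A adv T - u) := by
  simp only [regret, Finset.sum_range_succ, inner_sub_right]
  ring

/-- The prediction `z` of online gradient descent when it is fed with the gradients of the game
between `A` and `adv`. -/
def ogdIterate (A : Algorithm d) (adv : Adversary d) (t : ℕ) : E d := ogd t (history A adv t)

/-- The value of the statistic `S` before round `t` of the game between `A` and `adv`. -/
def gameStatistic (A : Algorithm d) (adv : Adversary d) (t : ℕ) : ℝ :=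
  statistic t (history A adv t)

theorem ogdIterate_succ (A : Algorithm d) (adv : Adversary d) (t : ℕ) :
    ogdIterate A adv (t + 1) =
      projBall (ogdIterate A adv t - (1 / √((t : ℝ) + 1)) • lossGradient A adv t) := by
  rw [ogdIterate, ogd, init_history, lossGradient, ogdIterate]

theorem norm_ogdIterate_le (A : Algorithm d) (adv : Adversary d) (t : ℕ) :
    ‖ogdIterate A adv t‖ ≤ 1 := by
  cases t with
  | zero => simp [ogdIterate, ogd]
  | succ t => exact ogdIterate_succ A adv t ▸ norm_projBall_le _

theorem gameStatistic_succ (A : Algorithm d) (adv : Adversary d) (t : ℕ) :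
    gameStatistic A adv (t + 1) =
      gameStatistic A adv t - inner ℝ (lossGradient A adv t) (ogdIterate A adv t) := by
  rw [gameStatistic, statistic, init_history, lossGradient, gameStatistic, ogdIterate]

theorem gameStatistic_eq_neg_sum (A : Algorithm d) (adv : Adversary d) (T : ℕ) :
    gameStatistic A adv T =
      -∑ t ∈ Finset.range T, inner ℝ (lossGradient A adv t) (ogdIterate A adv t) := by
  induction T with
  | zero => simp [gameStatistic, statistic]
  | succ T ih => rw [gameStatistic_succ, ih, Finset.sum_range_succ]; ring

theorem sum_inner_ogdIterate_sub_le (A : Algorithm d) (adv : Adversary d) (T : ℕ) {v : E d}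
    (hv : ‖v‖ ≤ 1) :
    ∑ t ∈ Finset.range T, inner ℝ (lossGradient A adv t) (ogdIterate A adv t - v)
      ≤ 3 * √(T : ℝ) :=
  sum_inner_sub_le_of_projBall_step (norm_ogdIterate_le A adv) (norm_lossGradient_le A adv)
    (ogdIterate_succ A adv) hv T

theorem abs_inner_lossGradient_ogdIterate_le (A : Algorithm d) (adv : Adversary d) (t : ℕ) :
    |inner ℝ (lossGradient A adv t) (ogdIterate A adv t)| ≤ 1 :=
  (abs_real_inner_le_norm _ _).trans
    (mul_le_one₀ (norm_lossGradient_le A adv t) (norm_nonneg _) (norm_ogdIterate_le A adv t))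

theorem neg_sum_inner_le (A : Algorithm d) (adv : Adversary d) (T : ℕ) (u : E d) :
    -∑ t ∈ Finset.range T, inner ℝ (lossGradient A adv t) u ≤
      ‖u‖ * gameStatistic A adv T + 3 * ‖u‖ * √(T : ℝ) := by
  obtain ⟨v, hv, hu⟩ : ∃ v : E d, ‖v‖ ≤ 1 ∧ ‖u‖ • v = u :=
    ⟨‖u‖⁻¹ • u, by simp [norm_smul, inv_mul_le_one], by
      rcases eq_or_ne u 0 with rfl | hu
      · simp
      · rw [smul_inv_smul₀ (norm_ne_zero_iff.2 hu)]⟩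
  have hogd := mul_le_mul_of_nonneg_left (sum_inner_ogdIterate_sub_le A adv T hv) (norm_nonneg u)
  simp only [inner_sub_right, Finset.sum_sub_distrib] at hogd
  rw [gameStatistic_eq_neg_sum]
  conv_lhs => rw [← hu]
  simp only [real_inner_smul_right, ← Finset.mul_sum]
  linarith

/-- A convex supersolution of the discrete backward heat equation: the condition on a potential
under which the losses of `potentialAlgorithm d V` telescope. -/
structure IsPotential (V : ℝ → ℝ → ℝ) : Prop where
  convexOn : ∀ t, 0 < t → ConvexOn ℝ univ (V t)
  walkAverage_le : ∀ t, 0 < t → ∀ S, walkAverage (V (t + 1)) S ≤ V t S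

theorem isPotential_potentialHalf {C : ℝ} (hC : 0 ≤ C) : IsPotential (potentialHalf C) where
  convexOn t _ := convexOn_potentialHalf hC t
  walkAverage_le _ ht := walkAverage_potentialHalf_le hC ht

theorem prediction_potentialAlgorithm (V : ℝ → ℝ → ℝ) (adv : Adversary d) (t : ℕ) :
    prediction (potentialAlgorithm d V) adv t =
      ((V ((t : ℝ) + 1) (gameStatistic (potentialAlgorithm d V) adv t + 1)
        - V ((t : ℝ) + 1) (gameStatistic (potentialAlgorithm d V) adv t - 1)) / 2) •
        ogdIterate (potentialAlgorithm d V) adv t := rfl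

theorem regret_zero_add_le_of_isPotential {V : ℝ → ℝ → ℝ} (hV : IsPotential V)
    (adv : Adversary d) (T : ℕ) :
    regret (potentialAlgorithm d V) adv (T + 1) 0
      + V ((T : ℝ) + 1) (gameStatistic (potentialAlgorithm d V) adv (T + 1)) ≤ V 1 0 := by
  induction T with
  | zero =>
    simp [regret, prediction_potentialAlgorithm, gameStatistic, statistic,
      ogdIterate, ogd]
  | succ T ih =>
    rw [regret_succ, sub_zero, gameStatistic_succ, prediction_potentialAlgorithm,
      real_inner_smul_right]
    push_cast
    set A := potentialAlgorithm d V
    have hpos : (0 : ℝ) < T + 1 := by positivity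
    have hchord := le_chord_of_convexOn
      ((hV.convexOn ((T : ℝ) + 1 + 1) (by positivity)).subset (subset_univ _) (convex_Icc _ _))
      (abs_inner_lossGradient_ogdIterate_le A adv (T + 1)) (x := gameStatistic A adv (T + 1))
    have haverage := hV.walkAverage_le _ hpos (gameStatistic A adv (T + 1))
    rw [walkAverage_apply] at haverage
    linarith

theorem regret_potentialAlgorithm_le {V : ℝ → ℝ → ℝ} (hV : IsPotential V) (adv : Adversary d)
    {T : ℕ} (hT : 0 < T) {u : E d} {K : ℝ} (hK : ∀ S, ‖u‖ * S - V T S ≤ K) :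
    regret (potentialAlgorithm d V) adv T u ≤ V 1 0 + K + 3 * ‖u‖ * √(T : ℝ) := by
  obtain ⟨T, rfl⟩ := Nat.exists_eq_add_one_of_ne_zero hT.ne'
  have hloss := regret_zero_add_le_of_isPotential hV adv T
  have hcomparator := neg_sum_inner_le (potentialAlgorithm d V) adv (T + 1) u
  have hconj := hK (gameStatistic (potentialAlgorithm d V) adv (T + 1))
  rw [regret_eq_regret_zero_sub]
  push_cast at hconj ⊢ hcomparator
  linarith

theorem neg_mul_sqrt_le_potentialHalf {C : ℝ} (hC : 0 ≤ C) (t S : ℝ) :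
    -(C * √t) ≤ potentialHalf C t S := by
  have hprofile : 0 ≤ C * √t * expSqDoubleIntegral (S / √(2 * t)) :=
    mul_nonneg (by positivity) (expSqDoubleIntegral_nonneg _)
  rw [potentialHalf_eq]
  linarith

theorem regret_algorithmHalf_zero_le {C : ℝ} (hC : 0 ≤ C) (adv : Adversary d) {T : ℕ}
    (hT : 0 < T) : regret (algorithmHalf d C) adv T 0 ≤ C * √(T : ℝ) := by
  have hregret := regret_potentialAlgorithm_le (u := 0) (isPotential_potentialHalf hC) adv hT
    (K := C * √(T : ℝ)) fun S => by
      simpa [neg_le] using neg_mul_sqrt_le_potentialHalf hC T S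
  rw [potentialHalf_one_zero, norm_zero] at hregret
  rw [algorithmHalf]
  linarith

theorem regret_algorithmHalf_le {C : ℝ} (hC : 0 < C) (adv : Adversary d) {T : ℕ} (hT : 0 < T)
    {u : E d} (hu : 1 ≤ ‖u‖) :
    regret (algorithmHalf d C) adv T u ≤
      √(T : ℝ) * (‖u‖ * (√2 * √(Real.log ‖u‖) + (1 / C + C + 3))) := by
  have hregret := regret_potentialAlgorithm_le (isPotential_potentialHalf hC.le) adv hT
    (mul_sub_potentialHalf_le hC (Nat.cast_pos.2 hT) hu)
  rw [potentialHalf_one_zero] at hregret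
  have hCu : √(T : ℝ) * C ≤ √(T : ℝ) * (C * ‖u‖) :=
    mul_le_mul_of_nonneg_left (le_mul_of_one_le_right hC.le hu) (Real.sqrt_nonneg _)
  rw [algorithmHalf]
  linear_combination hregret + hCu + hC

theorem limsup_limsup_le_of_tendsto {α β L : Type*} [CompleteLinearOrder L] [TopologicalSpace L]
    [OrderTopology L] {f : Filter α} [f.NeBot] {g : Filter β} {w : α → β → L} {b : α → L} {l : L}
    (hw : ∀ᶠ x in f, ∀ᶠ y in g, w x y ≤ b x) (hb : Tendsto b f (𝓝 l)) :
    limsup (fun x => limsup (w x) g) f ≤ l := by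
  rw [← hb.limsup_eq]
  exact limsup_le_limsup (hw.mono fun x hx => limsup_le_of_le (h := hx))

theorem le_liminf_liminf_of_tendsto {α β L : Type*} [CompleteLinearOrder L] [TopologicalSpace L]
    [OrderTopology L] {f : Filter α} [f.NeBot] {g : Filter β} {w : α → β → L} {b : α → L} {l : L}
    (hw : ∀ᶠ x in f, ∀ᶠ y in g, b x ≤ w x y) (hb : Tendsto b f (𝓝 l)) :
    l ≤ liminf (fun x => liminf (w x) g) f :=
  limsup_limsup_le_of_tendsto (L := Lᵒᵈ) hw hb

theorem tendsto_add_const_div_sqrt_log (a K : ℝ) :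
    Tendsto (fun U : ℝ => ((a + K / √(Real.log U) : ℝ) : EReal)) atTop (𝓝 (a : EReal)) := by
  have hdiv : Tendsto (fun U : ℝ => K / √(Real.log U)) atTop (𝓝 0) :=
    (Real.tendsto_sqrt_atTop.comp Real.tendsto_log_atTop).const_div_atTop K
  refine (continuous_coe_real_ereal.tendsto a).comp ?_
  simpa using hdiv.const_add a

theorem add_const_div_sqrt_log_mul (a K τ : ℝ) {U : ℝ} (hU : 1 < U) :
    (a + K / √(Real.log U)) * (U * √(τ * Real.log U)) = √τ * (U * (a * √(Real.log U) + K)) := by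
  have hlog : 0 < √(Real.log U) := Real.sqrt_pos.2 (Real.log_pos hU)
  rw [Real.sqrt_mul' τ (Real.log_pos hU).le]
  field_simp

theorem worstRatio_le {A : Algorithm d} {a K U : ℝ} {T : ℕ} (hU : 1 < U) (hT : 0 < T)
    (hA : ∀ (adv : Adversary d) (u : E d), ‖u‖ = U →
      regret A adv T u ≤ √(T : ℝ) * (U * (a * √(Real.log U) + K))) :
    worstRatio A U T ≤ ((a + K / √(Real.log U) : ℝ) : EReal) := by
  refine iSup_le fun u => iSup_le fun hu => iSup_le fun adv => EReal.coe_le_coe_iff.2 ?_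
  have hlog := Real.log_pos hU
  rw [hu, div_le_iff₀ (by positivity), add_const_div_sqrt_log_mul a K T hU]
  exact hA adv u hu

theorem le_worstRatio {A : Algorithm d} {adv : Adversary d} {u : E d} {a K : ℝ} {T : ℕ}
    (hu : 1 < ‖u‖) (hT : 0 < T)
    (hA : √(T : ℝ) * (‖u‖ * (a * √(Real.log ‖u‖) + K)) ≤ regret A adv T u) :
    ((a + K / √(Real.log ‖u‖) : ℝ) : EReal) ≤ worstRatio A ‖u‖ T := by
  refine le_iSup_of_le u (le_iSup_of_le rfl (le_iSup_of_le adv (EReal.coe_le_coe_iff.2 ?_)))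
  have hlog := Real.log_pos hu
  rwa [le_div_iff₀ (by positivity), add_const_div_sqrt_log_mul a K T hu]

theorem limsup_worstRatio_algorithmHalf_le {C : ℝ} (hC : 0 < C) :
    limsup (fun U : ℝ => limsup (fun T : ℕ => worstRatio (algorithmHalf d C) U T) atTop) atTop
      ≤ ((√2 : ℝ) : EReal) := by
  refine limsup_limsup_le_of_tendsto ?_ (tendsto_add_const_div_sqrt_log √2 (1 / C + C + 3))
  filter_upwards [eventually_gt_atTop 1] with U hU
  filter_upwards [eventually_gt_atTop 0] with T hT
  refine worstRatio_le hU hT fun adv u hu => ?_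
  subst hu
  exact regret_algorithmHalf_le hC adv hT hU.le

/-! ### The random-walk adversary -/

theorem history_update (A : Algorithm d) (adv : Adversary d) {t T : ℕ} (ht : t ≤ T)
    (r : (Fin (T + 1) → E d) → Gradient d) :
    history A (Function.update adv T r) t = history A adv t := by
  induction t with
  | zero => rfl
  | succ t ih => rw [history, history, ih (by lia), Function.update_of_ne (by lia)]

theorem prediction_update (A : Algorithm d) (adv : Adversary d) {t T : ℕ} (ht : t ≤ T)
    (r : (Fin (T + 1) → E d) → Gradient d) :
    prediction A (Function.update adv T r) t = prediction A adv t := by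
  rw [prediction, history_update A adv ht, prediction]

theorem lossGradient_update_of_lt (A : Algorithm d) (adv : Adversary d) {t T : ℕ} (ht : t < T)
    (r : (Fin (T + 1) → E d) → Gradient d) :
    lossGradient A (Function.update adv T r) t = lossGradient A adv t := by
  rw [lossGradient, history_update A adv ht, lossGradient]

theorem lossGradient_update_self (A : Algorithm d) (adv : Adversary d) (T : ℕ) (g : Gradient d) :
    lossGradient A (Function.update adv T fun _ => g) T = g := by
  simp [lossGradient, history]

theorem regret_update (A : Algorithm d) (adv : Adversary d) (T : ℕ)
    (r : (Fin (T + 1) → E d) → Gradient d) (u : E d) :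
    regret A (Function.update adv T r) T u = regret A adv T u := by
  simp only [regret]
  congr 1 <;> refine Finset.sum_congr rfl fun t ht => ?_
  · rw [lossGradient_update_of_lt A adv (Finset.mem_range.1 ht),
      prediction_update A adv (Finset.mem_range.1 ht).le]
  · rw [lossGradient_update_of_lt A adv (Finset.mem_range.1 ht)]

theorem exists_gradient_walkAverage_le {e : E d} (he : ‖e‖ = 1) (x : E d) (f : ℝ → ℝ) (S : ℝ) :
    ∃ g : Gradient d,
      walkAverage f S ≤ inner ℝ (g : E d) x + f (S - inner ℝ (g : E d) e) := by
  have hee : inner ℝ e e = (1 : ℝ) := by rw [real_inner_self_eq_norm_sq, he, one_pow]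
  rw [walkAverage_apply]
  rcases le_total (-inner ℝ e x + f (S + 1)) (inner ℝ e x + f (S - 1)) with h | h
  · exact ⟨⟨e, by simp [he]⟩, by rw [hee]; linarith⟩
  · refine ⟨⟨-e, by simp [he]⟩, ?_⟩
    rw [inner_neg_left, inner_neg_left, hee, sub_neg_eq_add]
    linarith

theorem exists_adversary_walkAverage_pow_le (A : Algorithm d) {e : E d} (he : ‖e‖ = 1) (T : ℕ)
    (f : ℝ → ℝ) :
    ∃ adv : Adversary d, (walkAverage ^ T) f 0 ≤
      regret A adv T 0 + f (regret A adv T e - regret A adv T 0) := by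
  induction T generalizing f with
  | zero => exact ⟨fun _ _ => ⟨0, by simp⟩, by simp [regret]⟩
  | succ T ih =>
    obtain ⟨adv, hadv⟩ := ih (walkAverage f)
    obtain ⟨g, hg⟩ := exists_gradient_walkAverage_le he (prediction A adv T) f
      (regret A adv T e - regret A adv T 0)
    refine ⟨Function.update adv T fun _ => g, ?_⟩
    have hwalk : regret A adv T e + inner ℝ (g : E d) (prediction A adv T - e)
        - (regret A adv T 0 + inner ℝ (g : E d) (prediction A adv T))
        = regret A adv T e - regret A adv T 0 - inner ℝ (g : E d) e := by
      rw [inner_sub_right]; ring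
    rw [pow_succ, Module.End.mul_apply, regret_succ, regret_succ, regret_update, regret_update,
      lossGradient_update_self, prediction_update A adv le_rfl, sub_zero, hwalk]
    linarith

theorem walkAverage_pow_exp (m : ℝ) (n : ℕ) :
    (walkAverage ^ n) (fun S => Real.exp (m * S)) =
      Real.cosh m ^ n • fun S => Real.exp (m * S) := by
  have hstep : walkAverage (fun S => Real.exp (m * S)) =
      Real.cosh m • fun S => Real.exp (m * S) := by
    ext S
    rw [walkAverage_apply, mul_add, mul_sub, mul_one, sub_eq_add_neg, Real.exp_add, Real.exp_add,
      Pi.smul_apply, smul_eq_mul, Real.cosh_eq]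
    ring
  exact Module.End.HasEigenvector.pow_apply
    ⟨Module.End.mem_eigenspace_iff.2 hstep, fun h => (Real.exp_pos _).ne' (congrFun h 0)⟩ n

theorem one_add_sq_div_two_le_cosh (x : ℝ) : 1 + x ^ 2 / 2 ≤ Real.cosh x := by
  have hdouble : Real.cosh x = 1 + 2 * Real.sinh (x / 2) ^ 2 := by
    have hcosh := Real.cosh_two_mul (x / 2)
    rw [mul_div_cancel₀ x two_ne_zero, Real.cosh_sq] at hcosh
    linarith
  have hsinh : (x / 2) ^ 2 ≤ Real.sinh (x / 2) ^ 2 := by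
    rw [sq_le_sq, Real.abs_sinh]
    exact Real.self_le_sinh_iff.2 (abs_nonneg _)
  linarith

theorem tendsto_cosh_div_sqrt_pow (μ : ℝ) :
    Tendsto (fun T : ℕ => Real.cosh (μ / √(T : ℝ)) ^ T) atTop (𝓝 (Real.exp (μ ^ 2 / 2))) := by
  have hsq (T : ℕ) : (μ / √(T : ℝ)) ^ 2 / 2 = μ ^ 2 / 2 / T := by
    rw [div_pow, Real.sq_sqrt T.cast_nonneg, div_right_comm]
  refine tendsto_of_tendsto_of_tendsto_of_le_of_le'
    (Real.tendsto_one_add_div_pow_exp (μ ^ 2 / 2)) tendsto_const_nhds ?_ ?_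
  · filter_upwards with T
    rw [← hsq]
    exact pow_le_pow_left₀ (by positivity) (one_add_sq_div_two_le_cosh _) T
  · filter_upwards [eventually_gt_atTop 0] with T hT
    refine (pow_le_pow_left₀ (Real.cosh_pos _).le (Real.cosh_le_exp_half_sq _) T).trans_eq ?_
    rw [hsq, ← Real.exp_nat_mul, mul_div_cancel₀ _ (by positivity)]

/-- The density of the normal distribution with mean `μ` and variance `1` relative to that with
mean `0`, which normalizes the exponential eigenfunctions of the random walk. -/
def gaussianTilt (μ x : ℝ) : ℝ := Real.exp (μ * x - μ ^ 2 / 2)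

/-- A combination of exponentials that is positive only near `l`: playing against its random walk
average forces the endpoint of the walk, in units of `√T`, close to `l`. -/
def bump (l x : ℝ) : ℝ :=
  2 * gaussianTilt l x
    - Real.exp (1 / 2) / 2 * (gaussianTilt (l + 1) x + gaussianTilt (l - 1) x)

theorem tendsto_walkAverage_pow_gaussianTilt (μ : ℝ) :
    Tendsto (fun T : ℕ => (walkAverage ^ T) (fun S => gaussianTilt μ (S / √(T : ℝ))) 0) atTop
      (𝓝 1) := by
  have htilt (T : ℕ) : (fun S => gaussianTilt μ (S / √(T : ℝ))) =
      Real.exp (-(μ ^ 2 / 2)) • fun S => Real.exp (μ / √(T : ℝ) * S) := by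
    ext S
    rw [gaussianTilt, Pi.smul_apply, smul_eq_mul, ← Real.exp_add]
    congr 1
    ring
  have hlimit := (tendsto_cosh_div_sqrt_pow μ).const_mul (Real.exp (-(μ ^ 2 / 2)))
  rw [← Real.exp_add, neg_add_cancel, Real.exp_zero] at hlimit
  simpa [htilt, walkAverage_pow_exp] using hlimit

theorem tendsto_walkAverage_pow_bump (l : ℝ) :
    Tendsto (fun T : ℕ => (walkAverage ^ T) (fun S => bump l (S / √(T : ℝ))) 0) atTop
      (𝓝 (2 - Real.exp (1 / 2))) := by
  have hlinear (T : ℕ) : (fun S => bump l (S / √(T : ℝ))) =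
      (2 : ℝ) • (fun S => gaussianTilt l (S / √(T : ℝ))) - (Real.exp (1 / 2) / 2) •
        ((fun S => gaussianTilt (l + 1) (S / √(T : ℝ)))
          + fun S => gaussianTilt (l - 1) (S / √(T : ℝ))) := rfl
  have hlimit := ((tendsto_walkAverage_pow_gaussianTilt l).const_mul 2).sub
    (((tendsto_walkAverage_pow_gaussianTilt (l + 1)).add
      (tendsto_walkAverage_pow_gaussianTilt (l - 1))).const_mul (Real.exp (1 / 2) / 2))
  rw [show 2 - Real.exp (1 / 2) = 2 * 1 - Real.exp (1 / 2) / 2 * (1 + 1) by ring]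
  simpa only [hlinear, map_sub, map_add, map_smul, Pi.sub_apply, Pi.add_apply, Pi.smul_apply,
    smul_eq_mul] using hlimit

theorem eventually_lt_walkAverage_pow_bump (l : ℝ) :
    ∀ᶠ T : ℕ in atTop, 1 / 4 < (walkAverage ^ T) (fun S => bump l (S / √(T : ℝ))) 0 := by
  have hexp : Real.exp (1 / 2) < 7 / 4 := by
    refine lt_of_pow_lt_pow_left₀ 2 (by norm_num) ?_
    rw [← Real.exp_nat_mul, Nat.cast_ofNat, mul_one_div_cancel two_ne_zero]
    exact Real.exp_one_lt_three.trans (by norm_num)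
  exact (tendsto_walkAverage_pow_bump l).eventually_const_lt (by linarith)

theorem bump_eq (l x : ℝ) : bump l x = gaussianTilt l x * (2 - Real.cosh (x - l)) := by
  have hright : Real.exp (1 / 2) * gaussianTilt (l + 1) x =
      gaussianTilt l x * Real.exp (x - l) := by
    simp only [gaussianTilt, ← Real.exp_add]
    congr 1
    ring
  have hleft : Real.exp (1 / 2) * gaussianTilt (l - 1) x =
      gaussianTilt l x * Real.exp (-(x - l)) := by
    simp only [gaussianTilt, ← Real.exp_add]
    congr 1
    ring
  rw [bump, Real.cosh_eq]
  linear_combination -(hright + hleft) / 2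

theorem abs_sub_le_of_bump_pos {l x : ℝ} (h : 0 < bump l x) : |x - l| ≤ 2 := by
  rw [bump_eq] at h
  have hcosh : 0 < 2 - Real.cosh (x - l) := pos_of_mul_pos_right h (Real.exp_pos _).le
  have hquadratic := one_add_sq_div_two_le_cosh (x - l)
  exact abs_le_of_sq_le_sq (by linarith) zero_le_two

theorem bump_le {l x : ℝ} (h : |x| ≤ l + 2) : bump l x ≤ Real.exp ((l + 2) ^ 2 / 2) := by
  rw [bump_eq]
  refine (mul_le_of_le_one_right (Real.exp_pos _).le
    (by linarith [Real.one_le_cosh (x - l)])).trans (Real.exp_le_exp.2 ?_)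
  linarith [sq_nonneg (x - l), sq_le_sq' (neg_le_of_abs_le h) (le_of_abs_le h)]

theorem exists_adversary_le_regret (A : Algorithm d) {e : E d} (he : ‖e‖ = 1) {C : ℝ} (hC : 0 < C)
    {T : ℕ} (hT : 0 < T) (hA : ∀ adv : Adversary d, regret A adv T 0 ≤ C * √(T : ℝ)) {l : ℝ}
    (hl : 0 ≤ l) (hbump : 1 / 4 < (walkAverage ^ T) (fun S => bump l (S / √(T : ℝ))) 0) {U : ℝ}
    (hU : 0 ≤ U) :
    ∃ adv : Adversary d, √(T : ℝ) * (U * (l - 2) - 4 * C * Real.exp ((l + 2) ^ 2 / 2))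
      ≤ regret A adv T (U • e) := by
  have hroot : 0 < √(T : ℝ) := Real.sqrt_pos.2 (by positivity)
  have hscale : 0 < 4 * C * √(T : ℝ) := by positivity
  obtain ⟨adv, hadv⟩ := exists_adversary_walkAverage_pow_le A he T
    ((4 * C * √(T : ℝ)) • fun S => bump l (S / √(T : ℝ)))
  refine ⟨adv, ?_⟩
  set S := regret A adv T e - regret A adv T 0 with hS
  rw [map_smul, Pi.smul_apply, Pi.smul_apply, smul_eq_mul, smul_eq_mul] at hadv
  have hstart := mul_lt_mul_of_pos_left hbump hscale
  have hpos : 0 < bump l (S / √(T : ℝ)) :=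
    pos_of_mul_pos_right (by linarith [hA adv]) hscale.le
  obtain ⟨hlower, hupper⟩ := abs_le.1 (abs_sub_le_of_bump_pos hpos)
  have hle := mul_le_mul_of_nonneg_left
    (bump_le (abs_le.2 ⟨by linarith, by linarith⟩) : bump l (S / √(T : ℝ)) ≤ _) hscale.le
  have hendpoint : (l - 2) * √(T : ℝ) ≤ S := by
    rw [← le_div_iff₀ hroot]; linarith
  have hregret : regret A adv T (U • e) = regret A adv T 0 + U * S := by
    rw [hS, regret_eq_regret_zero_sub A adv T e, regret_eq_regret_zero_sub A adv T (U • e)]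
    simp only [real_inner_smul_right, ← Finset.mul_sum]
    ring
  rw [hregret]
  linarith [mul_le_mul_of_nonneg_left hendpoint hU, mul_pos hC hroot]

theorem exists_adversary_sqrt_log_le_regret (A : Algorithm d) {e : E d} (he : ‖e‖ = 1) {C : ℝ}
    (hC : 0 < C) {T : ℕ} (hT : 0 < T)
    (hA : ∀ adv : Adversary d, regret A adv T 0 ≤ C * √(T : ℝ)) {U : ℝ} (hU : Real.exp 2 ≤ U)
    (hbump : 1 / 4 < (walkAverage ^ T)
      (fun S => bump (√2 * √(Real.log U) - 2) (S / √(T : ℝ))) 0) :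
    ∃ adv : Adversary d,
      √(T : ℝ) * (U * (√2 * √(Real.log U) + -(4 + 4 * C))) ≤ regret A adv T (U • e) := by
  have hU₀ : 0 < U := (Real.exp_pos 2).trans_le hU
  have hlog : 2 ≤ Real.log U := (Real.le_log_iff_exp_le hU₀).2 hU
  have hl : 0 ≤ √2 * √(Real.log U) - 2 := by
    rw [sub_nonneg, ← Real.sqrt_mul zero_le_two]
    exact Real.le_sqrt_of_sq_le (by linarith)
  obtain ⟨adv, hadv⟩ := exists_adversary_le_regret A he hC hT hA hl hbump hU₀.le
  refine ⟨adv, hadv.trans' (le_of_eq ?_)⟩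
  have hexp : Real.exp ((√2 * √(Real.log U) - 2 + 2) ^ 2 / 2) = U := by
    rw [sub_add_cancel, mul_pow, Real.sq_sqrt zero_le_two, Real.sq_sqrt (by linarith),
      mul_div_cancel_left₀ _ two_ne_zero, Real.exp_log hU₀]
  rw [hexp]
  ring

theorem le_liminf_worstRatio (hd : 0 < d) (C : ℝ) (A : Algorithm d)
    (hA : ∀ (adv : Adversary d) (T : ℕ), 0 < T → regret A adv T 0 ≤ C * √(T : ℝ)) :
    ((√2 : ℝ) : EReal) ≤
      liminf (fun U : ℝ => liminf (fun T : ℕ => worstRatio A U T) atTop) atTop := by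
  obtain ⟨e, he⟩ : ∃ e : E d, ‖e‖ = 1 := ⟨EuclideanSpace.single ⟨0, hd⟩ 1, by simp⟩
  have hC : 0 < max C 1 := lt_max_of_lt_right one_pos
  refine le_liminf_liminf_of_tendsto ?_
    (tendsto_add_const_div_sqrt_log √2 (-(4 + 4 * max C 1)))
  filter_upwards [eventually_ge_atTop (Real.exp 2)] with U hU
  filter_upwards [eventually_gt_atTop 0,
    eventually_lt_walkAverage_pow_bump (√2 * √(Real.log U) - 2)] with T hT hbump
  have hU₁ : 1 < U := (Real.one_lt_exp_iff.2 two_pos).trans_le hU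
  have hnorm : ‖U • e‖ = U := by
    rw [norm_smul, he, mul_one, Real.norm_of_nonneg (by linarith)]
  obtain ⟨adv, hadv⟩ := exists_adversary_sqrt_log_le_regret A he hC hT
    (fun adv => (hA adv T hT).trans (by gcongr; exact le_max_left _ _)) hU hbump
  simpa only [hnorm] using le_worstRatio (u := U • e) (by rwa [hnorm]) hT (by rwa [hnorm])

end

end OLO

theorem mainTheorem2 (d : ℕ) (hd : 0 < d) :
    -- upper bound for the algorithm `A_{1/2}`
    (∀ C : ℝ, 0 < C →
      Filter.limsup (fun U : ℝ =>
        Filter.limsup (fun T : ℕ => OLO.worstRatio (OLO.algorithmHalf d C) U T) Filter.atTop)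
        Filter.atTop ≤ ((√2 : ℝ) : EReal)) ∧
    -- lower bound for every algorithm whose cumulative loss is at most `C √T`
    (∀ (C : ℝ) (A : OLO.Algorithm d),
      (∀ (adv : OLO.Adversary d) (T : ℕ), 0 < T → OLO.regret A adv T 0 ≤ C * √(T : ℝ)) →
      ((√2 : ℝ) : EReal) ≤
        Filter.liminf (fun U : ℝ =>
          Filter.liminf (fun T : ℕ => OLO.worstRatio A U T) Filter.atTop)
          Filter.atTop) ∧
    -- `A_{1/2}` is such an algorithm
    (∀ C : ℝ, 0 < C → ∀ (adv : OLO.Adversary d) (T : ℕ), 0 < T →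
      OLO.regret (OLO.algorithmHalf d C) adv T 0 ≤ C * √(T : ℝ)) :=
  ⟨fun _ hC => OLO.limsup_worstRatio_algorithmHalf_le hC,
    fun C A hA => OLO.le_liminf_worstRatio hd C A hA,
    fun _ hC adv _ hT => OLO.regret_algorithmHalf_zero_le hC.le adv hT⟩
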